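/- Let $k\ge 2$, $\mathcal A=\{1,\dots,k\}$ and $T=\mathbb N$ or $T=\mathbb Z$. For $x\in\mathcal A^{T}$ let $F_x(n)=\{x_j\cdots x_{j+n-1}: j\in T\}$ ($n\ge 0$) and $F_x=\bigcup_n F_x(n)$. A factor $u\in F_x$ is right-special (left-special) if there are distinct symbols $a,b$ with $ua,ub\in F_x$ ($au,bu\in F_x$), and bispecial if it is both. The sequence $x$ is an Arnoux--Rauzy (AR) sequence if every factor of $x$ occurs in $x$ with bounded gaps, $|F_x(n)|=(k-1)n+1$ for every $n\ge 0$, and each $F_x(n)$ contains exactly one right-special and exactly one left-special factor. The associated AR subshift is $X=\{y\in\mathcal A^{T}: F_y(n)=F_x(n)\text{ for all }n\}$; write $F_X=F_x$ for its set of factors. Its index is $$\mathrm{ind}(X)=\sup\{p\in\mathbb N:\ u^p\in F_X\text{ for some nonempty word }u\}\in\mathbb N\cup\{\infty\}.$$ Let $w_1,w_2,\dots$ be the bispecial factors of $X$, ordered so that $0=|w_1|<|w_2|<\cdots$. The index sequence $(i_n)_{n\ge1}$ of $X$ is defined by letting $i_n\in\mathcal A$ be the unique symbol such that $i_nw_n$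 is right-special. An $r$-run in $(i_n)$ is a pair $(a,l)$, with $a\in\mathcal A$ and $l\ge1$, such that $i_m=a$ for $l\le m\le l+r-1$. Corollary. For every AR subshift $X$ (one-sided or two-sided) over $k\ge2$ symbols, the index sequence $(i_n)$ is well defined (it exists and is unique), and $\mathrm{ind}(X)<\infty$ if and only if there is a $B\in\mathbb N$ such that $r\le B$ whenever $(i_n)$ contains an $r$-run. -/

import Mathlib

namespace ArnouxRauzy

section Words

/-- The word `x_j x_{j+1} … x_{j+n-1}`. The index set `T` is `ℕ` for one-sided and `ℤ` for
two-sided sequences. -/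
def word {T A : Type*} [AddMonoidWithOne T] (x : T → A) (j : T) (n : ℕ) : List A :=
  List.ofFn fun t : Fin n => x (j + ((t : ℕ) : T))

/-- `F_x(n)`: the set of all factors (subwords) of `x` of length `n`. -/
def factorsOfLength {T A : Type*} [AddMonoidWithOne T] (x : T → A) (n : ℕ) : Set (List A) :=
  {u | ∃ j : T, u = word x j n}

/-- `F_x`: the set of all factors of `x`. -/
def factors {T A : Type*} [AddMonoidWithOne T] (x : T → A) : Set (List A) :=
  {u | ∃ n : ℕ, u ∈ factorsOfLength x n}

/-- The power `u^p`. -/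
def wordPow {A : Type*} (u : List A) (p : ℕ) : List A :=
  (List.replicate p u).flatten

/-- `u` is a right-special element of the set of factors `F`. -/
def IsRightSpecial {A : Type*} (F : Set (List A)) (u : List A) : Prop :=
  u ∈ F ∧ ∃ a b : A, a ≠ b ∧ u ++ [a] ∈ F ∧ u ++ [b] ∈ F

/-- `u` is a left-special element of the set of factors `F`. -/
def IsLeftSpecial {A : Type*} (F : Set (List A)) (u : List A) : Prop :=
  u ∈ F ∧ ∃ a b : A, a ≠ b ∧ a :: u ∈ F ∧ b :: u ∈ F

/-- `u` is both right-special and left-special. -/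
def IsBispecial {A : Type*} (F : Set (List A)) (u : List A) : Prop :=
  IsRightSpecial F u ∧ IsLeftSpecial F u

/-- Every factor of `x` occurs in `x` with bounded gaps. -/
def IsUniformlyRecurrent {T A : Type*} [AddMonoidWithOne T] (x : T → A) : Prop :=
  ∀ u ∈ factors x, ∃ N : ℕ, ∀ j : T, ∃ m : ℕ, m ≤ N ∧ word x (j + (m : T)) u.length = u

end Words

section Subshifts

/-- `x` is an Arnoux-Rauzy sequence over an alphabet of `k` symbols. -/
structure IsARSequence {T : Type*} [AddMonoidWithOne T] {k : ℕ} (x : T → Fin k) : Prop where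
  uniformlyRecurrent : IsUniformlyRecurrent x
  complexity : ∀ n : ℕ, (factorsOfLength x n).ncard = (k - 1) * n + 1
  rightSpecial : ∀ n : ℕ, ∃! u : List (Fin k), u.length = n ∧ IsRightSpecial (factors x) u
  leftSpecial : ∀ n : ℕ, ∃! u : List (Fin k), u.length = n ∧ IsLeftSpecial (factors x) u

/-- The subshift associated with `x`: all sequences with the same factors as `x`. -/
def subshift {T A : Type*} [AddMonoidWithOne T] (x : T → A) : Set (T → A) :=
  {y | ∀ n : ℕ, factorsOfLength y n = factorsOfLength x n}

/-- `X` is the subshift associated with some Arnoux-Rauzy sequence. -/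
def IsARSubshift {T : Type*} [AddMonoidWithOne T] {k : ℕ} (X : Set (T → Fin k)) : Prop :=
  ∃ x : T → Fin k, IsARSequence x ∧ X = subshift x

/-- `F_X`: the set of all factors of elements of `X`. -/
def language {T A : Type*} [AddMonoidWithOne T] (X : Set (T → A)) : Set (List A) :=
  {u | ∃ y ∈ X, u ∈ factors y}

/-- The integer index of `X`: the supremum in `ℕ ∪ {∞}` of all `p` such that `u ^ p` is a factor
of `X` for some nonempty word `u`. -/
noncomputable def index {T A : Type*} [AddMonoidWithOne T] (X : Set (T → A)) : ℕ∞ :=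
  sSup {q : ℕ∞ | ∃ p : ℕ, q = (p : ℕ∞) ∧ ∃ u : List A, u ≠ [] ∧ wordPow u p ∈ language X}

/-- `i` is the index sequence of `X`: if `w 0, w 1, w 2, …` are the bispecial factors in order of
increasing length, then `i n` is a symbol such that `(i n) (w n)` is right-special. -/
def IsIndexSequence {T A : Type*} [AddMonoidWithOne T] (X : Set (T → A)) (i : ℕ → A) : Prop :=
  ∃ w : ℕ → List A,
    StrictMono (fun n => (w n).length) ∧
    Set.range w = {u | IsBispecial (language X) u} ∧
    ∀ n : ℕ, IsRightSpecial (language X) (i n :: w n)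

end Subshifts

section Runs

/-- The pair `(a, l)` is an `r`-run in `i`, that is, `i m = a` for `l ≤ m ≤ l + r - 1`. -/
def IsRun {A : Type*} (i : ℕ → A) (r : ℕ) (a : A) (l : ℕ) : Prop :=
  ∀ m : ℕ, l ≤ m → m < l + r → i m = a

/-- The lengths of the runs in `i` are uniformly bounded. -/
def RunsBounded {A : Type*} (i : ℕ → A) : Prop :=
  ∃ B : ℕ, ∀ (r : ℕ) (a : A) (l : ℕ), IsRun i r a l → r ≤ B

end Runs

end ArnouxRauzy

/-!
The proof works with the language `F` of the subshift alone (`IsARLanguage`), so that one-sided and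
two-sided subshifts are treated together. The complexity condition forces the right-special factor
of length `n` to have all `k` right extensions, and dually on the left
(`IsARSequence.isARLanguage`). Right-special words form a chain under suffixes and left-special
words a chain under prefixes. Between two consecutive bispecial words extensions are forced
(`left_completion`, `right_completion`), and every length is exceeded by that of a bispecial word
(`exists_bispecial`); this gives the existence and the uniqueness of the index sequence.

*Long runs give high powers.* Let `w` and `W = y w` be consecutive bispecial words such that `a w`
and `a W` are right-special. Then the next bispecial word is `y W` (`next_bispecial_of_rs_cons`).
What has to be seen is that the letter `a'` for which `w a'` is left-special also makes `W a'`
left-special; otherwise `W a'` would have only one left extension, and extending it to the left again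
and again would produce all powers of `y`, which recurrence excludes (`ls_append_of_rs_cons`).
Along a run of length `r` starting at `w` the bispecial words are therefore `w, y w, …, y ^ r w`,
and `y ^ r` is in `F`.

*High powers give long runs.* Suppose that `F` contains a `p`-th power, let `q` be the least positive period
for which `F` has a word of length at least `p q`, and let `v` be a longest word of period `q` in
`F`. By maximality `v` without one period is bispecial (`bispecial_drop_of_maximal`), hence so is `v`
without `j ≥ 1` periods. For small `j` these words are consecutive bispecial words: another one in
between would be a border, and the theorem of Fine and Wilf would yield a period of at most `q / 2`,
against the minimality of `q` (`le_length_of_bispecial`). Inside `v` they are all preceded by the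
same letter, which yields a run of length `(p - 1) / 2` (`exists_isRun_of_wordPow_mem`).
-/

namespace ArnouxRauzy

/-! ### Abstract Arnoux–Rauzy languages -/

/-- The properties of the set of factors of an Arnoux–Rauzy sequence on which the argument rests.
Unlike the sequence, they are invariant under reversal of words. -/
structure IsARLanguage {A : Type*} (F : Set (List A)) : Prop where
  left_mem : ∀ {u v : List A}, u ++ v ∈ F → u ∈ F
  right_mem : ∀ {u v : List A}, u ++ v ∈ F → v ∈ F
  exists_append : ∀ {u : List A}, u ∈ F → ∃ a, u ++ [a] ∈ F
  exists_cons : ∀ {u : List A}, u ∈ F → ∃ a, a :: u ∈ F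
  existsUnique_rs : ∀ n : ℕ, ∃! u : List A, u.length = n ∧ IsRightSpecial F u
  existsUnique_ls : ∀ n : ℕ, ∃! u : List A, u.length = n ∧ IsLeftSpecial F u
  rs_full : ∀ {u : List A}, IsRightSpecial F u → ∀ a, u ++ [a] ∈ F
  ls_full : ∀ {u : List A}, IsLeftSpecial F u → ∀ a, a :: u ∈ F
  recurrent : ∀ {u : List A}, u ∈ F → ∃ N : ℕ, ∀ v ∈ F, N ≤ v.length → u <:+: v

variable {A : Type*} {F : Set (List A)}

theorem isRightSpecial_reverse {u : List A} :
    IsRightSpecial (List.reverse ⁻¹' F) u ↔ IsLeftSpecial F u.reverse := by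
  simp [IsRightSpecial, IsLeftSpecial]

theorem isLeftSpecial_reverse {u : List A} :
    IsLeftSpecial (List.reverse ⁻¹' F) u ↔ IsRightSpecial F u.reverse := by
  simp [IsRightSpecial, IsLeftSpecial]

theorem isBispecial_reverse {u : List A} :
    IsBispecial (List.reverse ⁻¹' F) u ↔ IsBispecial F u.reverse := by
  rw [IsBispecial, isRightSpecial_reverse, isLeftSpecial_reverse, IsBispecial, and_comm]

namespace IsARLanguage

theorem reverse (h : IsARLanguage F) : IsARLanguage (List.reverse ⁻¹' F) where
  left_mem := fun {u v} huv => h.right_mem (u := v.reverse) (by simpa using huv)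
  right_mem := fun {u v} huv => h.left_mem (v := u.reverse) (by simpa using huv)
  exists_append := fun hu => by simpa using h.exists_cons hu
  exists_cons := fun hu => by simpa using h.exists_append hu
  existsUnique_rs := fun n => by
    obtain ⟨u, ⟨hu, hu'⟩, huniq⟩ := h.existsUnique_ls n
    refine ⟨u.reverse, ⟨by simpa using hu, isRightSpecial_reverse.2 (by simpa using hu')⟩, ?_⟩
    rintro v ⟨hv, hv'⟩
    rw [← huniq v.reverse ⟨by simpa using hv, isRightSpecial_reverse.1 hv'⟩, List.reverse_reverse]
  existsUnique_ls := fun n => by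
    obtain ⟨u, ⟨hu, hu'⟩, huniq⟩ := h.existsUnique_rs n
    refine ⟨u.reverse, ⟨by simpa using hu, isLeftSpecial_reverse.2 (by simpa using hu')⟩, ?_⟩
    rintro v ⟨hv, hv'⟩
    rw [← huniq v.reverse ⟨by simpa using hv, isLeftSpecial_reverse.1 hv'⟩, List.reverse_reverse]
  rs_full := fun hu a => by simpa using h.ls_full (isRightSpecial_reverse.1 hu) a
  ls_full := fun hu a => by simpa using h.rs_full (isLeftSpecial_reverse.1 hu) a
  recurrent := fun hu => by
    obtain ⟨N, hN⟩ := h.recurrent hu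
    exact ⟨N, fun v hv hlen => List.reverse_infix.1 (hN _ hv (by simpa using hlen))⟩

theorem mem_of_infix (h : IsARLanguage F) {u v : List A} (huv : u <:+: v) (hv : v ∈ F) :
    u ∈ F := by
  obtain ⟨s, t, rfl⟩ := huv
  exact h.right_mem (h.left_mem hv)

theorem rs_of_append (h : IsARLanguage F) {u v : List A} (hu : IsRightSpecial F (u ++ v)) :
    IsRightSpecial F v := by
  obtain ⟨hm, a, b, hab, ha, hb⟩ := hu
  rw [List.append_assoc] at ha hb
  exact ⟨h.right_mem hm, a, b, hab, h.right_mem ha, h.right_mem hb⟩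

theorem ls_of_append (h : IsARLanguage F) {u v : List A} (hu : IsLeftSpecial F (u ++ v)) :
    IsLeftSpecial F u := by
  obtain ⟨hm, a, b, hab, ha, hb⟩ := hu
  rw [← List.cons_append] at ha hb
  exact ⟨h.left_mem hm, a, b, hab, h.left_mem ha, h.left_mem hb⟩

theorem rs_eq (h : IsARLanguage F) {u v : List A} (hu : IsRightSpecial F u)
    (hv : IsRightSpecial F v) (huv : u.length = v.length) : u = v :=
  (h.existsUnique_rs v.length).unique ⟨huv, hu⟩ ⟨rfl, hv⟩

theorem rs_suffix (h : IsARLanguage F) {u v : List A} (hu : IsRightSpecial F u)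
    (hv : IsRightSpecial F v) (huv : u.length ≤ v.length) : u <:+ v := by
  have hd : IsRightSpecial F (v.drop (v.length - u.length)) :=
    h.rs_of_append (u := v.take (v.length - u.length)) (by simpa using hv)
  rw [h.rs_eq hu hd (by simp; omega)]
  exact List.drop_suffix _ _

theorem ls_prefix (h : IsARLanguage F) {u v : List A} (hu : IsLeftSpecial F u)
    (hv : IsLeftSpecial F v) (huv : u.length ≤ v.length) : u <+: v := by
  have := h.reverse.rs_suffix (u := u.reverse) (v := v.reverse)
    (isRightSpecial_reverse.2 (by simpa using hu)) (isRightSpecial_reverse.2 (by simpa using hv))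
    (by simpa using huv)
  simpa using this

theorem exists_left_extension (h : IsARLanguage F) {u : List A} (hu : u ∈ F) (n : ℕ) :
    ∃ p : List A, p.length = n ∧ p ++ u ∈ F := by
  induction n with
  | zero => exact ⟨[], rfl, hu⟩
  | succ n ih =>
    obtain ⟨p, hp, hpu⟩ := ih
    obtain ⟨a, ha⟩ := h.exists_cons hpu
    exact ⟨a :: p, by simp [hp], ha⟩

/-! ### Forced extensions between bispecial words -/

/-- As long as no bispecial word is met, the left extension of a right-special word is forced: each
intermediate word is right-special, hence not left-special. -/
theorem eq_of_rs_suffix (h : IsARLanguage F) {V W z : List A} (hV : IsRightSpecial F V)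
    (hW : IsRightSpecial F W) (hz : z ∈ F) (hVz : V <:+ z) (hlen : z.length = W.length)
    (hgap : ∀ B, IsBispecial F B → V.length ≤ B.length → W.length ≤ B.length) : z = W := by
  induction z generalizing W with
  | nil => exact (List.length_eq_zero_iff.1 hlen.symm).symm
  | cons c z ih =>
    rcases List.suffix_cons_iff.1 hVz with rfl | hVz'
    · exact h.rs_eq hV hW hlen
    obtain _ | ⟨d, W⟩ := W
    · simp at hlen
    have hW' : IsRightSpecial F W := h.rs_of_append (u := [d]) hW
    have hlen' : z.length = W.length := by simpa using hlen
    have hzW : z = W := ih hW' (h.right_mem (u := [c]) hz) hVz' hlen' fun B hB hVB =>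
      (Nat.le_succ _).trans (hgap B hB hVB)
    subst hzW
    by_contra hne
    have := hgap z ⟨hW', hW'.1, c, d, fun hcd => hne (by rw [hcd]), hz, hW.1⟩ hVz'.length_le
    simp at this

theorem left_completion (h : IsARLanguage F) {V W s : List A} (hV : IsRightSpecial F V)
    (hW : IsRightSpecial F W) (hVW : V.length ≤ W.length)
    (hgap : ∀ B, IsBispecial F B → V.length ≤ B.length → W.length ≤ B.length)
    (hs : V ++ s ∈ F) : W ++ s ∈ F := by
  obtain ⟨p, hp, hps⟩ := h.exists_left_extension hs (W.length - V.length)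
  rw [← List.append_assoc] at hps
  have := h.eq_of_rs_suffix hV hW (h.left_mem hps) (List.suffix_append _ _)
    (by rw [List.length_append]; omega) hgap
  rwa [this] at hps

theorem right_completion (h : IsARLanguage F) {V W s : List A} (hV : IsLeftSpecial F V)
    (hW : IsLeftSpecial F W) (hVW : V.length ≤ W.length)
    (hgap : ∀ B, IsBispecial F B → V.length ≤ B.length → W.length ≤ B.length)
    (hs : s ++ V ∈ F) : s ++ W ∈ F := by
  have := h.reverse.left_completion (V := V.reverse) (W := W.reverse) (s := s.reverse)
    (isRightSpecial_reverse.2 (by simpa using hV)) (isRightSpecial_reverse.2 (by simpa using hW))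
    (by simpa using hVW)
    (fun B hB => by simpa using hgap B.reverse (isBispecial_reverse.1 hB)) (by simpa using hs)
  simpa using this

theorem exists_bispecial (h : IsARLanguage F) (n : ℕ) :
    ∃ B, IsBispecial F B ∧ n ≤ B.length := by
  by_contra! hno
  obtain ⟨V, ⟨hVn, hV⟩, -⟩ := h.existsUnique_rs n
  obtain ⟨N, hN⟩ := h.recurrent hV.1
  obtain ⟨L, ⟨hLN, hL⟩, -⟩ := h.existsUnique_ls N
  obtain ⟨p, s, rfl⟩ := hN L hL.1 hLN.ge
  have hpV : IsLeftSpecial F (p ++ V) := h.ls_of_append hL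
  obtain ⟨W, ⟨hWlen, hW⟩, -⟩ := h.existsUnique_rs (p ++ V).length
  have hgap : ∀ B, IsBispecial F B → V.length ≤ B.length → W.length ≤ B.length :=
    fun B hB hVB => absurd (hno B hB) (by omega)
  have := h.eq_of_rs_suffix hV hW hpV.1 (List.suffix_append _ _) hWlen.symm hgap
  have hlt := hno _ ⟨this ▸ hW, hpV⟩
  simp at hlt
  omega

end IsARLanguage

/-! ### Periods of words -/

theorem wordPow_succ (u : List A) (p : ℕ) : wordPow u (p + 1) = u ++ wordPow u p := by
  simp [wordPow, List.replicate_succ]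

theorem wordPow_succ' (u : List A) (p : ℕ) : wordPow u (p + 1) = wordPow u p ++ u := by
  simp [wordPow, List.replicate_succ']

theorem length_wordPow (u : List A) (p : ℕ) : (wordPow u p).length = p * u.length := by
  simp [wordPow]

theorem hasPeriod_wordPow (u : List A) (p : ℕ) : (wordPow u p).HasPeriod u.length := by
  rw [List.hasPeriod_iff_getElem?]
  intro n hn
  obtain _ | p := p
  · simp [wordPow] at hn
  have h1 : (wordPow u (p + 1))[n + u.length]? = (wordPow u p)[n]? := by
    rw [wordPow_succ, List.getElem?_append_right (by omega), Nat.add_sub_cancel]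
  have h2 : (wordPow u (p + 1))[n]? = (wordPow u p)[n]? := by
    rw [wordPow_succ', List.getElem?_append_left]
    rw [wordPow_succ', List.length_append] at hn
    omega
  rw [h1, h2]

theorem hasPeriod_mul {q : ℕ} {v : List A} (hv : v.HasPeriod q) (j : ℕ) :
    v.HasPeriod (j * q) := by
  rw [List.hasPeriod_iff_getElem?] at hv ⊢
  induction j with
  | zero => intro n _; simp
  | succ j ih =>
    intro n hn
    rw [Nat.succ_mul] at hn ⊢
    rw [ih n (by omega), hv (n + j * q) (by omega), Nat.add_assoc]

theorem drop_eq_take_of_hasPeriod {q : ℕ} {v : List A} (hv : v.HasPeriod q) :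
    v.drop q = v.take (v.length - q) := by
  simpa using List.prefix_iff_eq_take.1 hv.drop_prefix

/-- A word with a border of length `|v| - q` has period `q`. -/
theorem hasPeriod_of_border {q : ℕ} {v B : List A} (hpre : B <+: v) (hsuf : B <:+ v)
    (hlen : B.length + q = v.length) : v.HasPeriod q := by
  have hB : B = v.drop q := by
    rw [List.suffix_iff_eq_drop.1 hsuf]
    congr 1
    omega
  rw [List.HasPeriod]
  nth_rw 1 [← List.take_append_drop q v]
  rw [List.prefix_append_right_inj, ← hB]
  exact hpre

/-- Words in the language with a given period are bounded in length: a long one would contain all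
words `Ra` with `R` right-special of length `q`, but period `q` forces `a` to be the first letter
of `R`. -/
theorem IsARLanguage.exists_length_lt_of_hasPeriod (h : IsARLanguage F) {q : ℕ} (hq : 0 < q) :
    ∃ N, ∀ v ∈ F, v.HasPeriod q → v.length < N := by
  obtain ⟨R, ⟨hRq, -, a, b, hab, ha, hb⟩, -⟩ := h.existsUnique_rs q
  obtain ⟨Na, hNa⟩ := h.recurrent ha
  obtain ⟨Nb, hNb⟩ := h.recurrent hb
  refine ⟨max Na Nb, fun v hv hper => ?_⟩
  by_contra! hlen
  have h1 := List.hasPeriod_iff_getElem?.1 (hper.infix (hNa v hv (by omega))) 0 (by simp [hRq])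
  have h2 := List.hasPeriod_iff_getElem?.1 (hper.infix (hNb v hv (by omega))) 0 (by simp [hRq])
  rw [Nat.zero_add, List.getElem?_append_left (i := 0) (by omega), ← hRq,
    List.getElem?_concat_length] at h1 h2
  exact hab (Option.some_injective _ (h1.symm.trans h2))

theorem IsARLanguage.exists_wordPow_notMem (h : IsARLanguage F) {y : List A} (hy : y ≠ []) :
    ∃ n, wordPow y n ∉ F := by
  have hpos := List.length_pos_iff.2 hy
  obtain ⟨N, hN⟩ := h.exists_length_lt_of_hasPeriod hpos
  refine ⟨N, fun hmem => ?_⟩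
  have := hN _ hmem (hasPeriod_wordPow y N)
  rw [length_wordPow] at this
  nlinarith

namespace IsARLanguage

/-! ### Runs produce powers -/

/-- Let `w` and `W = y w` be consecutive bispecial words. If the right-special extensions `a w` and
`a W` are by the same letter, then the left-special extensions `w a'` and `W a''` are as well.
Otherwise `W a'` is always preceded by `y`, and this occurrence of `y` belongs to an earlier
occurrence of `W a'`, so that `F` would contain all powers of `y`. -/
theorem ls_append_of_rs_cons (h : IsARLanguage F) {w y t : List A} {a a' : A} (hy : y ≠ [])
    (hWr : IsRightSpecial F (y ++ w)) (hWt : y ++ w = w ++ t)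
    (hgap : ∀ B, IsBispecial F B → w.length < B.length → (y ++ w).length ≤ B.length)
    (haw : IsRightSpecial F (a :: w)) (haW : IsRightSpecial F (a :: (y ++ w)))
    (hpre : w ++ [a'] <+: y ++ w) : IsLeftSpecial F (y ++ w ++ [a']) := by
  have hpos := List.length_pos_iff.2 hy
  have hleft : ∀ s, a :: w ++ s ∈ F → y ++ w ++ s ∈ F := fun s =>
    h.left_completion haw hWr (by simp; omega) fun B hB hlen => hgap B hB (by simpa using hlen)
  have hmem : a :: (y ++ w ++ [a']) ∈ F := h.rs_full haW a'
  obtain ⟨t', ht'⟩ : ∃ t', t = a' :: t' := by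
    obtain ⟨t', ht'⟩ := hpre
    rw [hWt, List.append_assoc, List.append_cancel_left_eq] at ht'
    exact ⟨t', ht'.symm⟩
  by_contra hls
  have hpre' : ∀ s, y ++ w ++ [a'] ++ s ∈ F → y ++ (y ++ w ++ [a'] ++ s) ∈ F := by
    intro s hs
    obtain ⟨d, hd⟩ := h.exists_cons hs
    have hda : d = a := by
      by_contra hne
      exact hls ⟨h.left_mem hs, d, a, hne, h.left_mem (v := s) (by simpa using hd), hmem⟩
    have h1 := hleft (t ++ [a'] ++ s) (by
      subst hda
      rw [hWt] at hd
      simpa using hd)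
    have h2 : y ++ w ++ (t ++ [a'] ++ s) = y ++ ((w ++ t) ++ [a'] ++ s) := by simp
    rw [h2, ← hWt] at h1
    exact h1
  have hpow : ∀ n s, y ++ w ++ [a'] ++ s ∈ F → wordPow y n ++ (y ++ w ++ [a'] ++ s) ∈ F := by
    intro n
    induction n with
    | zero => intro s hs; simpa [wordPow] using hs
    | succ n ih =>
      intro s hs
      -- `y W = W t` and `t` starts with `a'`
      have h1 : y ++ (y ++ w ++ [a'] ++ s) = y ++ w ++ [a'] ++ (t' ++ [a'] ++ s) := by
        have h2 : y ++ (y ++ w ++ [a'] ++ s) = y ++ (y ++ w) ++ [a'] ++ s := by simp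
        rw [h2, hWt, ht', ← List.append_assoc y w, hWt, ht']
        simp
      have h3 := ih (t' ++ [a'] ++ s) (h1 ▸ hpre' s hs)
      rw [← h1] at h3
      rw [wordPow_succ', List.append_assoc]
      exact h3
  obtain ⟨n, hn⟩ := h.exists_wordPow_notMem hy
  exact hn (h.left_mem (hpow n [] (by simpa using h.right_mem (u := [a]) hmem)))

/-- If `w` and `W = y w` are consecutive bispecial words whose right-special extensions are by the
same letter, then the next bispecial word is `y W`. -/
theorem next_bispecial_of_rs_cons (h : IsARLanguage F) {w y : List A} {a : A} (hy : y ≠ [])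
    (hw : IsBispecial F w) (hW : IsBispecial F (y ++ w))
    (hgap : ∀ B, IsBispecial F B → w.length < B.length → (y ++ w).length ≤ B.length)
    (haw : IsRightSpecial F (a :: w)) (haW : IsRightSpecial F (a :: (y ++ w))) :
    IsBispecial F (y ++ (y ++ w)) ∧
      ∀ B, IsBispecial F B → (y ++ w).length < B.length →
        (y ++ (y ++ w)).length ≤ B.length := by
  have hpos := List.length_pos_iff.2 hy
  obtain ⟨t, ht⟩ := h.ls_prefix hw.2 hW.2 (by simp)
  obtain ⟨L, ⟨hLlen, hL⟩, -⟩ := h.existsUnique_ls (w.length + 1)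
  obtain ⟨s, rfl⟩ := h.ls_prefix hw.2 hL (by omega)
  obtain ⟨a', rfl⟩ : ∃ a', s = [a'] := List.length_eq_one_iff.1 (by simpa using hLlen)
  have hpre : w ++ [a'] <+: y ++ w := h.ls_prefix hL hW.2 (by simp; omega)
  have hWa' := h.ls_append_of_rs_cons hy hW.1 ht.symm hgap haw haW hpre
  have hleft : ∀ s, a :: w ++ s ∈ F → y ++ w ++ s ∈ F := fun s =>
    h.left_completion haw hW.1 (by simp; omega) fun B hB hlen => hgap B hB (by simpa using hlen)
  have hright : ∀ s, s ++ (w ++ [a']) ∈ F → s ++ (y ++ w) ∈ F := fun s =>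
    h.right_completion hL hW.2 (by simp; omega) fun B hB hlen => hgap B hB (by simpa using hlen)
  have hrs : IsRightSpecial F (y ++ (y ++ w)) := by
    have hall : ∀ b, y ++ (y ++ w) ++ [b] ∈ F := by
      intro b
      have h1 := hleft (t ++ [b]) (by
        have := h.rs_full haW b
        rw [← ht] at this
        simpa using this)
      rw [← ht]
      simpa using h1
    obtain ⟨-, b, c, hbc, -, -⟩ := haW
    exact ⟨h.left_mem (hall b), b, c, hbc, hall b, hall c⟩
  have hls : IsLeftSpecial F (y ++ (y ++ w)) := by
    obtain ⟨-, b, c, hbc, hb, hc⟩ := hWa'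
    have hb' := hright (b :: y) (by simpa using hb)
    have hc' := hright (c :: y) (by simpa using hc)
    exact ⟨hrs.1, b, c, hbc, hb', hc'⟩
  refine ⟨⟨hrs, hls⟩, fun B hB hlt => ?_⟩
  by_contra! hlt'
  -- a bispecial word `B = p W` in between would yield the bispecial word `p w` between `w` and `W`
  obtain ⟨p, rfl⟩ := h.rs_suffix hW.1 hB.1 hlt.le
  obtain ⟨s, hs⟩ := h.rs_suffix hB.1 hrs hlt'.le
  rw [← List.append_assoc, List.append_cancel_right_eq] at hs
  have hpw : IsBispecial F (p ++ w) := by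
    constructor
    · have := hW.1
      rw [← hs, List.append_assoc] at this
      exact h.rs_of_append this
    · have := hB.2
      rw [← ht, ← List.append_assoc] at this
      exact h.ls_of_append this
  have := hgap _ hpw (by simp at hlt ⊢; omega)
  simp at this hlt'
  omega

end IsARLanguage

/-! ### Enumerations of the bispecial words -/

/-- The words `w 0, w 1, …` are the bispecial words in order of increasing length. -/
def IsBispecialEnumeration (F : Set (List A)) (w : ℕ → List A) : Prop :=
  StrictMono (fun n => (w n).length) ∧ Set.range w = {u | IsBispecial F u}

namespace IsBispecialEnumeration

theorem bispecial {w : ℕ → List A} (hw : IsBispecialEnumeration F w) (n : ℕ) :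
    IsBispecial F (w n) := by
  have : w n ∈ Set.range w := ⟨n, rfl⟩
  rwa [hw.2] at this

theorem exists_eq {w : ℕ → List A} (hw : IsBispecialEnumeration F w) {V : List A}
    (hV : IsBispecial F V) : ∃ n, w n = V := by
  have : V ∈ Set.range w := by rwa [hw.2]
  exact this

theorem gap {w : ℕ → List A} (hw : IsBispecialEnumeration F w) {n : ℕ} {V : List A}
    (hV : IsBispecial F V) (hlt : (w n).length < V.length) : (w (n + 1)).length ≤ V.length := by
  obtain ⟨m, rfl⟩ := hw.exists_eq hV
  exact hw.1.monotone (hw.1.lt_iff_lt.1 hlt)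

theorem eq_succ {w : ℕ → List A} (hw : IsBispecialEnumeration F w) {n : ℕ} {V : List A}
    (hV : IsBispecial F V) (hlt : (w n).length < V.length)
    (hgap : ∀ B, IsBispecial F B → (w n).length < B.length → V.length ≤ B.length) :
    w (n + 1) = V := by
  obtain ⟨m, rfl⟩ := hw.exists_eq hV
  have h1 := hw.gap hV hlt
  have h2 := hgap _ (hw.bispecial (n + 1)) (hw.1 (Nat.lt_succ_self n))
  rw [hw.1.injective (le_antisymm h1 h2)]

end IsBispecialEnumeration

theorem IsARLanguage.exists_wordPow_mem_of_isRun (h : IsARLanguage F) {w : ℕ → List A}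
    {i : ℕ → A} (hw : IsBispecialEnumeration F w) (hi : ∀ n, IsRightSpecial F (i n :: w n))
    {r l : ℕ} {a : A} (hrun : IsRun i r a l) : ∃ u : List A, u ≠ [] ∧ wordPow u r ∈ F := by
  obtain ⟨y, hy⟩ := h.rs_suffix (hw.bispecial l).1 (hw.bispecial (l + 1)).1
    (hw.1 (Nat.lt_succ_self l)).le
  have hne : y ≠ [] := by
    rintro rfl
    exact (hw.1 (Nat.lt_succ_self l)).ne (congrArg List.length hy)
  have hstep : ∀ n, n < r → w (l + n + 1) = y ++ w (l + n) := by
    intro n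
    induction n with
    | zero => exact fun _ => hy.symm
    | succ n ih =>
      intro hn
      have heq := ih (by omega)
      have h1 := hi (l + n)
      have h2 := hi (l + n + 1)
      rw [hrun _ (by omega) (by omega)] at h1 h2
      obtain ⟨hb, hgap⟩ := h.next_bispecial_of_rs_cons hne (hw.bispecial (l + n))
        (heq ▸ hw.bispecial (l + n + 1)) (fun B hB hlt => heq ▸ hw.gap hB hlt) h1 (heq ▸ h2)
      rw [← heq] at hb hgap
      exact hw.eq_succ hb (by simpa using List.length_pos_iff.2 hne) hgap
  have hpow : ∀ n, n ≤ r → w (l + n) = wordPow y n ++ w l := by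
    intro n
    induction n with
    | zero => intro _; simp [wordPow]
    | succ n ih =>
      intro hn
      rw [← Nat.add_assoc, hstep n hn, ih (by omega), wordPow_succ, List.append_assoc]
  exact ⟨y, hne, h.left_mem (hpow r le_rfl ▸ (hw.bispecial (l + r)).1.1)⟩

namespace IsARLanguage

/-! ### Powers produce runs -/

/-- Among the words of `F` with period `q`, take a longest one. Deleting one period from it leaves a
bispecial word: it is followed, and likewise preceded, both by the letter that continues the period
and by a letter that breaks it. -/
theorem bispecial_drop_of_maximal (h : IsARLanguage F) {v : List A} {q : ℕ} (hq : 0 < q)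
    (hqv : q ≤ v.length) (hv : v ∈ F) (hper : v.HasPeriod q)
    (hmax : ∀ z ∈ F, z.HasPeriod q → z.length ≤ v.length) : IsBispecial F (v.drop q) := by
  have htake := drop_eq_take_of_hasPeriod hper
  have hmem : v.drop q ∈ F := h.mem_of_infix (List.drop_suffix q v).isInfix hv
  constructor
  · obtain ⟨b, hb⟩ := h.exists_append hv
    have hd : v.drop q ++ [v[v.length - q]] <+: v := by
      rw [htake, List.take_append_getElem]
      exact List.take_prefix _ _
    have hsuf : v.drop q ++ [b] <:+ v ++ [b] :=
      ⟨v.take q, by rw [← List.append_assoc, List.take_append_drop]⟩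
    refine ⟨hmem, v[v.length - q], b, fun heq => ?_, h.mem_of_infix hd.isInfix hv,
      h.mem_of_infix hsuf.isInfix hb⟩
    rw [heq] at hd
    have := hmax _ hb (hasPeriod_of_border (hd.trans (List.prefix_append _ _)) hsuf
      (by simp; omega))
    simp at this
  · obtain ⟨c, hc⟩ := h.exists_cons hv
    have hd : v[q - 1] :: v.drop q <:+ v := by
      have : v[q - 1] :: v.drop (q - 1 + 1) = v.drop (q - 1) :=
        (List.drop_eq_getElem_cons (by omega)).symm
      rw [Nat.sub_add_cancel hq] at this
      rw [this]
      exact List.drop_suffix _ _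
    have hpre : c :: v.drop q <+: c :: v :=
      (List.prefix_cons_inj c).2 (htake ▸ List.take_prefix _ _)
    refine ⟨hmem, v[q - 1], c, fun heq => ?_, h.mem_of_infix hd.isInfix hv,
      h.mem_of_infix hpre.isInfix hc⟩
    rw [heq] at hd
    have := hmax _ hc (hasPeriod_of_border hpre (hd.trans (List.suffix_cons _ _))
      (by simp; omega))
    simp at this

theorem bispecial_drop_mul_of_maximal (h : IsARLanguage F) {v : List A} {q j : ℕ} (hq : 0 < q)
    (hj : 0 < j) (hqv : q ≤ v.length) (hv : v ∈ F) (hper : v.HasPeriod q)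
    (hmax : ∀ z ∈ F, z.HasPeriod q → z.length ≤ v.length) :
    IsBispecial F (v.drop (j * q)) := by
  have hb := h.bispecial_drop_of_maximal hq hqv hv hper hmax
  have hle : q ≤ j * q := Nat.le_mul_of_pos_left q hj
  constructor
  · have hsuf : v.drop (j * q) <:+ v.drop q := List.drop_suffix_drop_left v hle
    obtain ⟨s, hs⟩ := hsuf
    exact h.rs_of_append (hs ▸ hb.1)
  · have hpre : v.drop (j * q) <+: v.drop q := by
      rw [drop_eq_take_of_hasPeriod (hasPeriod_mul hper j), drop_eq_take_of_hasPeriod hper]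
      exact List.take_prefix_take_left (by omega)
    obtain ⟨s, hs⟩ := hpre
    exact h.ls_of_append (hs ▸ hb.2)

/-- If `q` is the least period with exponent `p` in `F`, no bispecial word has a length strictly
between those of `v.drop ((j + 1) * q)` and `v.drop (j * q)`. Such a word would be a border of the
latter, and by the theorem of Fine and Wilf the word would have a period which is a proper divisor
of `q`, hence at most `q / 2`; halving the period makes up for the loss of half the length. -/
theorem le_length_of_bispecial (h : IsARLanguage F) {v B : List A} {p q j : ℕ} (hq : 0 < q)
    (hmin : ∀ d, 0 < d → ∀ z ∈ F, z.HasPeriod d → p * d ≤ z.length → q ≤ d)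
    (hv : v ∈ F) (hper : v.HasPeriod q) (hlen : p * q ≤ v.length) (hjp : 2 * j ≤ p)
    (hjp' : j + 2 ≤ p) (hvj : IsBispecial F (v.drop (j * q))) (hB : IsBispecial F B)
    (hlt : (v.drop ((j + 1) * q)).length < B.length) : (v.drop (j * q)).length ≤ B.length := by
  by_contra! hlt'
  have hpre := h.ls_prefix hB.2 hvj.2 hlt'.le
  have hsuf := h.rs_suffix hB.1 hvj.1 hlt'.le
  have hjq : (j + 1) * q = j * q + q := Nat.succ_mul j q
  have hpq : p * q = j * q + (p - j) * q := by
    rw [← Nat.add_mul, Nat.add_sub_cancel' (by omega)]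
  have h2q : 2 * q ≤ (p - j) * q := Nat.mul_le_mul_right q (by omega)
  have hvjlen : (v.drop (j * q)).length = v.length - j * q := List.length_drop
  have hvjlen' : (v.drop ((j + 1) * q)).length = v.length - (j + 1) * q := List.length_drop
  obtain ⟨q', hq'⟩ : ∃ q', B.length + q' = (v.drop (j * q)).length :=
    ⟨_, Nat.add_sub_cancel' hlt'.le⟩
  have hq'pos : 0 < q' := by omega
  have hq'lt : q' < q := by omega
  have hgcd := (hper.infix (List.drop_suffix (j * q) v).isInfix).gcd
    (hasPeriod_of_border hpre hsuf hq') (by omega)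
  have hdpos : 0 < q.gcd q' := Nat.gcd_pos_of_pos_left _ hq
  have hdlt : q.gcd q' < q := (Nat.gcd_le_right q hq'pos).trans_lt hq'lt
  have h2d : 2 * q.gcd q' ≤ q := by
    obtain ⟨c, hc⟩ := Nat.gcd_dvd_left q q'
    have : 2 ≤ c := by
      by_contra! hc2
      interval_cases c <;> omega
    calc 2 * q.gcd q' ≤ c * q.gcd q' := Nat.mul_le_mul_right _ this
      _ = q := by rw [Nat.mul_comm]; exact hc.symm
  have hpd : p * q.gcd q' ≤ (p - j) * q :=
    calc p * q.gcd q' ≤ ((p - j) * 2) * q.gcd q' := Nat.mul_le_mul_right _ (by omega)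
      _ = (p - j) * (2 * q.gcd q') := Nat.mul_assoc _ _ _
      _ ≤ (p - j) * q := Nat.mul_le_mul_left _ h2d
  exact absurd (hmin _ hdpos _ (h.mem_of_infix (List.drop_suffix _ v).isInfix hv) hgcd (by omega))
    (by omega)

theorem exists_maximal_of_hasPeriod (h : IsARLanguage F) {q : ℕ} (hq : 0 < q) {u : List A}
    (hu : u ∈ F) (hper : u.HasPeriod q) :
    ∃ v ∈ F, v.HasPeriod q ∧ ∀ z ∈ F, z.HasPeriod q → z.length ≤ v.length := by
  obtain ⟨N, hN⟩ := h.exists_length_lt_of_hasPeriod hq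
  let S : Set ℕ := {n | ∃ v ∈ F, v.HasPeriod q ∧ v.length = n}
  have hbdd : BddAbove S := ⟨N, by rintro _ ⟨v, hv, hvper, rfl⟩; exact (hN v hv hvper).le⟩
  obtain ⟨v, hv, hvper, hvlen⟩ := Nat.sSup_mem (s := S) ⟨_, u, hu, hper, rfl⟩ hbdd
  exact ⟨v, hv, hvper, fun z hz hzper => hvlen ▸ le_csSup hbdd ⟨z, hz, hzper, rfl⟩⟩

theorem exists_isRun_of_wordPow_mem (h : IsARLanguage F) {w : ℕ → List A} {i : ℕ → A}
    (hw : IsBispecialEnumeration F w) (hi : ∀ n, IsRightSpecial F (i n :: w n)) {p : ℕ}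
    {u : List A} (hu : u ≠ []) (hup : wordPow u p ∈ F) : ∃ a l, IsRun i ((p - 1) / 2) a l := by
  classical
  -- for `p < 3` the run is empty
  rcases Nat.lt_or_ge p 3 with hp | hp
  · refine ⟨i 0, 0, fun m _ hm => ?_⟩
    omega
  have hex : ∃ q, 0 < q ∧ ∃ z ∈ F, z.HasPeriod q ∧ p * q ≤ z.length :=
    ⟨u.length, List.length_pos_iff.2 hu, _, hup, hasPeriod_wordPow u p, (length_wordPow u p).ge⟩
  obtain ⟨q, ⟨hq, z, hz, hzper, hzlen⟩, hmin'⟩ : ∃ q, (0 < q ∧ ∃ z ∈ F, z.HasPeriod q ∧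
      p * q ≤ z.length) ∧ ∀ d < q, ¬(0 < d ∧ ∃ z ∈ F, z.HasPeriod d ∧ p * d ≤ z.length) :=
    ⟨Nat.find hex, Nat.find_spec hex, fun d hd => Nat.find_min hex hd⟩
  have hmin : ∀ d, 0 < d → ∀ z ∈ F, z.HasPeriod d → p * d ≤ z.length → q ≤ d :=
    fun d hd z hz hzper hzlen => not_lt.1 fun hlt => hmin' d hlt ⟨hd, z, hz, hzper, hzlen⟩
  obtain ⟨v, hv, hper, hmax⟩ := h.exists_maximal_of_hasPeriod hq hz hzper
  have hlen : p * q ≤ v.length := hzlen.trans (hmax z hz hzper)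
  have hqv : q ≤ v.length := (Nat.le_mul_of_pos_left q (by omega)).trans hlen
  have hbis : ∀ j, 0 < j → IsBispecial F (v.drop (j * q)) := fun j hj =>
    h.bispecial_drop_mul_of_maximal hq hj hqv hv hper hmax
  have hshort : ∀ j, j < p →
      (v.drop ((j + 1) * q)).length + q = (v.drop (j * q)).length := by
    intro j hj
    have h1 : (j + 1) * q ≤ p * q := Nat.mul_le_mul_right q hj
    rw [List.length_drop, List.length_drop]
    rw [Nat.succ_mul] at h1 ⊢
    omega
  obtain ⟨r, hr⟩ : ∃ r, r = (p - 1) / 2 := ⟨_, rfl⟩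
  obtain ⟨l, hl⟩ := hw.exists_eq (hbis (r + 1) (Nat.succ_pos r))
  have hwt : ∀ t ≤ r, w (l + t) = v.drop ((r + 1 - t) * q) := by
    intro t
    induction t with
    | zero => exact fun _ => hl
    | succ t ih =>
      intro ht
      have hj : r + 1 - t = (r + 1 - (t + 1)) + 1 := by omega
      have heq := ih (by omega)
      rw [hj] at heq
      rw [← Nat.add_assoc]
      refine hw.eq_succ (hbis _ (by omega)) ?_ fun B hB hlt => ?_
      · rw [heq, ← hshort (r + 1 - (t + 1)) (by omega)]
        omega
      · rw [heq] at hlt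
        exact h.le_length_of_bispecial hq hmin hv hper hlen (by omega) (by omega)
          (hbis _ (by omega)) hB hlt
  -- the letter preceding each of the bispecial words inside `v`
  obtain ⟨a, ha⟩ : ∃ a, v[q - 1]? = some a := ⟨_, List.getElem?_eq_getElem (by omega)⟩
  refine ⟨a, l, fun m hlm hm => ?_⟩
  obtain ⟨t, rfl⟩ := Nat.exists_eq_add_of_le hlm
  obtain ⟨j, hj⟩ : ∃ j, r + 1 - t = j + 1 := ⟨r - t, by omega⟩
  have hrs := hi (l + t)
  rw [hwt t (by omega), hj] at hrs
  have hjlen := hshort j (by omega)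
  have hsuf := (h.rs_suffix hrs (hbis j (by omega)).1 (by rw [List.length_cons]; omega)).trans
    (List.drop_suffix _ _)
  have hdrop := List.suffix_iff_eq_drop.1 hsuf
  have hidx : v.length - (i (l + t) :: v.drop ((j + 1) * q)).length = q - 1 + j * q := by
    rw [List.length_cons]
    rw [List.length_drop] at hjlen ⊢
    rw [List.length_drop] at hjlen
    rw [Nat.succ_mul] at hjlen ⊢
    omega
  rw [hidx] at hdrop
  have h0 : v[q - 1 + j * q]? = some (i (l + t)) := by
    have := congrArg (fun z : List A => z[0]?) hdrop
    simpa using this.symm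
  have hlt : q - 1 < v.length - j * q := by
    rw [List.length_drop, List.length_drop] at hjlen
    omega
  rw [← List.hasPeriod_iff_getElem?.1 (hasPeriod_mul hper j) _ hlt, ha] at h0
  exact (Option.some_injective _ h0).symm

theorem bounded_powers_iff_runsBounded (h : IsARLanguage F) {w : ℕ → List A} {i : ℕ → A}
    (hw : IsBispecialEnumeration F w) (hi : ∀ n, IsRightSpecial F (i n :: w n)) :
    (∃ N : ℕ, ∀ (p : ℕ) (u : List A), u ≠ [] → wordPow u p ∈ F → p ≤ N) ↔ RunsBounded i := by
  constructor
  · rintro ⟨N, hN⟩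
    refine ⟨N, fun r a l hrun => ?_⟩
    obtain ⟨u, hu, hmem⟩ := h.exists_wordPow_mem_of_isRun hw hi hrun
    exact hN r u hu hmem
  · rintro ⟨B, hB⟩
    refine ⟨2 * B + 2, fun p u hu hmem => ?_⟩
    obtain ⟨a, l, hrun⟩ := h.exists_isRun_of_wordPow_mem hw hi hu hmem
    have := hB _ a l hrun
    omega

/-! ### The index sequence -/

theorem exists_bispecialEnumeration (h : IsARLanguage F) :
    ∃ w : ℕ → List A, IsBispecialEnumeration F w := by
  let S : Set ℕ := {n | ∃ u, IsBispecial F u ∧ u.length = n}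
  have hS : S.Infinite := by
    refine Set.infinite_of_forall_exists_gt fun n => ?_
    obtain ⟨B, hB, hlen⟩ := h.exists_bispecial (n + 1)
    exact ⟨B.length, ⟨B, hB, rfl⟩, hlen⟩
  have hmem : ∀ n, ∃ u, IsBispecial F u ∧ u.length = Nat.nth (· ∈ S) n := fun n =>
    Nat.nth_mem_of_infinite (p := (· ∈ S)) hS n
  choose w hw hwlen using hmem
  refine ⟨w, fun m n hmn => ?_, Set.ext fun u => ⟨?_, fun hu => ?_⟩⟩
  · simpa only [hwlen] using Nat.nth_strictMono (p := (· ∈ S)) hS hmn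
  · rintro ⟨n, rfl⟩
    exact hw n
  · have hran : u.length ∈ Set.range (Nat.nth (· ∈ S)) := by
      rw [Nat.range_nth_of_infinite (p := (· ∈ S)) hS]
      exact ⟨u, hu, rfl⟩
    obtain ⟨n, hn⟩ := hran
    exact ⟨n, h.rs_eq (hw n).1 hu.1 ((hwlen n).trans hn)⟩

theorem bispecialEnumeration_unique (h : IsARLanguage F) {w w' : ℕ → List A}
    (hw : IsBispecialEnumeration F w) (hw' : IsBispecialEnumeration F w') : w = w' := by
  have hlen : (fun n => (w n).length) = fun n => (w' n).length := by
    refine (hw.1.range_inj hw'.1).1 ?_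
    have h1 := Set.range_comp List.length w
    have h2 := Set.range_comp List.length w'
    rw [hw.2] at h1
    rw [hw'.2] at h2
    exact h1.trans h2.symm
  exact funext fun n => h.rs_eq (hw.bispecial n).1 (hw'.bispecial n).1 (congrFun hlen n)

theorem exists_rs_cons (h : IsARLanguage F) {u : List A} (hu : IsRightSpecial F u) :
    ∃ a, IsRightSpecial F (a :: u) := by
  obtain ⟨v, ⟨hvlen, hv⟩, -⟩ := h.existsUnique_rs (u.length + 1)
  obtain ⟨s, rfl⟩ := h.rs_suffix hu hv (by omega)
  obtain ⟨a, rfl⟩ : ∃ a, s = [a] := List.length_eq_one_iff.1 (by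
    rw [List.length_append] at hvlen
    omega)
  exact ⟨a, hv⟩

theorem existsUnique_index_letters (h : IsARLanguage F) :
    ∃! i : ℕ → A, ∃ w, IsBispecialEnumeration F w ∧ ∀ n, IsRightSpecial F (i n :: w n) := by
  obtain ⟨w, hw⟩ := h.exists_bispecialEnumeration
  choose i hi using fun n => h.exists_rs_cons (hw.bispecial n).1
  refine ⟨i, ⟨w, hw, hi⟩, ?_⟩
  rintro i' ⟨w', hw', hi'⟩
  obtain rfl := h.bispecialEnumeration_unique hw hw'
  funext n
  exact (List.cons_eq_cons.1 (h.rs_eq (hi' n) (hi n) (by simp))).1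

end IsARLanguage

end ArnouxRauzy

namespace ArnouxRauzy

/-! ### Factors of an Arnoux–Rauzy sequence -/

section Factors

variable {T A : Type*} [AddMonoidWithOne T] {x : T → A}

theorem length_word (x : T → A) (j : T) (n : ℕ) : (word x j n).length = n := by
  simp [word]

theorem word_mem_factors (x : T → A) (j : T) (n : ℕ) : word x j n ∈ factors x :=
  ⟨n, j, rfl⟩

theorem mem_factors_iff {u : List A} : u ∈ factors x ↔ ∃ j, u = word x j u.length := by
  constructor
  · rintro ⟨n, j, rfl⟩
    exact ⟨j, by rw [length_word]⟩
  · rintro ⟨j, hj⟩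
    exact ⟨_, j, hj⟩

theorem mem_factorsOfLength_iff {u : List A} {n : ℕ} :
    u ∈ factorsOfLength x n ↔ u ∈ factors x ∧ u.length = n := by
  constructor
  · rintro ⟨j, rfl⟩
    exact ⟨word_mem_factors x j n, length_word x j n⟩
  · rintro ⟨hu, rfl⟩
    exact mem_factors_iff.1 hu

theorem word_add (x : T → A) (j : T) (m n : ℕ) :
    word x j (m + n) = word x j m ++ word x (j + (m : T)) n := by
  simp [word, List.ofFn_add, add_assoc]

theorem word_one (x : T → A) (j : T) : word x j 1 = [x j] := by
  simp [word]

theorem mem_of_append_left {u v : List A} (h : u ++ v ∈ factors x) : u ∈ factors x := by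
  obtain ⟨j, hj⟩ := mem_factors_iff.1 h
  rw [List.length_append, word_add] at hj
  exact mem_factors_iff.2 ⟨j, (List.append_inj hj (length_word _ _ _).symm).1⟩

theorem mem_of_append_right {u v : List A} (h : u ++ v ∈ factors x) : v ∈ factors x := by
  obtain ⟨j, hj⟩ := mem_factors_iff.1 h
  rw [List.length_append, word_add] at hj
  exact mem_factors_iff.2 ⟨_, (List.append_inj hj (length_word _ _ _).symm).2⟩

theorem exists_append_mem_factors {u : List A} (hu : u ∈ factors x) :
    ∃ a, u ++ [a] ∈ factors x := by
  obtain ⟨j, hj⟩ := mem_factors_iff.1 hu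
  refine ⟨x (j + (u.length : T)), u.length + 1, j, ?_⟩
  rw [word_add, word_one, ← hj]

/-- By recurrence a factor also occurs at a positive position, so it extends to the left even when
`x` is one-sided. -/
theorem IsUniformlyRecurrent.exists_cons_mem_factors (hx : IsUniformlyRecurrent x) {u : List A}
    (hu : u ∈ factors x) : ∃ a, a :: u ∈ factors x := by
  obtain ⟨N, hN⟩ := hx u hu
  obtain ⟨m, -, hm⟩ := hN 1
  refine ⟨x m, 1 + u.length, (m : T), ?_⟩
  have hcomm : (m : T) + ((1 : ℕ) : T) = 1 + (m : T) := by
    rw [← Nat.cast_add, Nat.add_comm, Nat.cast_add, Nat.cast_one]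
  rw [word_add, word_one, hcomm, hm]
  rfl

theorem IsUniformlyRecurrent.exists_infix (hx : IsUniformlyRecurrent x) {u : List A}
    (hu : u ∈ factors x) : ∃ N : ℕ, ∀ v ∈ factors x, N ≤ v.length → u <:+: v := by
  obtain ⟨N, hN⟩ := hx u hu
  refine ⟨N + u.length, fun v hv hlen => ?_⟩
  obtain ⟨j, hj⟩ := mem_factors_iff.1 hv
  obtain ⟨m, hm, hmu⟩ := hN j
  obtain ⟨n, hn⟩ : ∃ n, v.length = m + u.length + n := ⟨v.length - (m + u.length), by omega⟩
  rw [hn, word_add, word_add, hmu] at hj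
  exact ⟨_, _, hj.symm⟩

end Factors

/-- If only one fibre of `f : S → R` has more than one element, then that fibre has at least
`|S| - |R| + 1` elements. -/
theorem ncard_add_one_le_of_injOn_compl_fibre {α β : Type*} {S : Set α} {R : Set β} {f : α → β}
    {b : β} (hR : R.Finite) (hb : b ∈ R) (hf : ∀ s ∈ S, f s ∈ R)
    (hinj : ∀ s ∈ S, ∀ t ∈ S, f s = f t → f s ≠ b → s = t) :
    S.ncard + 1 ≤ {s ∈ S | f s = b}.ncard + R.ncard := by
  have h1 : {s ∈ S | f s ≠ b}.ncard ≤ (R \ {b}).ncard := by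
    refine Set.ncard_le_ncard_of_injOn f (fun s hs => ⟨hf s hs.1, hs.2⟩) ?_
      (hR.subset Set.sdiff_subset)
    exact fun s hs t ht hst => hinj s hs.1 t ht.1 hst hs.2
  have h2 : (R \ {b}).ncard + 1 = R.ncard := Set.ncard_sdiff_singleton_add_one hb hR
  have h3 : S = {s ∈ S | f s = b} ∪ {s ∈ S | f s ≠ b} := by
    ext s
    by_cases hs : f s = b <;> simp [hs]
  have h4 : S.ncard ≤ {s ∈ S | f s = b}.ncard + {s ∈ S | f s ≠ b}.ncard := by
    conv_lhs => rw [h3]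
    exact Set.ncard_union_le _ _
  omega

namespace IsARSequence

variable {T : Type*} [AddMonoidWithOne T] {k : ℕ} {x : T → Fin k}

theorem finite_factorsOfLength (x : T → Fin k) (n : ℕ) : (factorsOfLength x n).Finite :=
  (List.finite_length_eq (Fin k) n).subset fun _ hu => (mem_factorsOfLength_iff.1 hu).2

/-- The set `S` stands for the one-letter extensions, on one side, of the factors of length `n`,
and `e` for the extension of the only special factor by a letter: since there are `k - 1` more
factors of length `n + 1` than of length `n`, all `k` extensions of the special factor occur. -/
theorem extension_mem (hx : IsARSequence x) {n : ℕ} {u : List (Fin k)}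
    {f : List (Fin k) → List (Fin k)} {e : Fin k → List (Fin k)} (hu : u ∈ factorsOfLength x n)
    (hf : ∀ s ∈ factorsOfLength x (n + 1), f s ∈ factorsOfLength x n)
    (hinj : ∀ s ∈ factorsOfLength x (n + 1), ∀ t ∈ factorsOfLength x (n + 1),
      f s = f t → f s ≠ u → s = t)
    (he : Function.Injective e) (hfe : ∀ s ∈ factorsOfLength x (n + 1), f s = u → ∃ a, e a = s)
    (a : Fin k) : e a ∈ factors x := by
  have hcard := ncard_add_one_le_of_injOn_compl_fibre
    (finite_factorsOfLength x n) hu hf hinj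
  rw [hx.complexity, hx.complexity, Nat.mul_succ] at hcard
  have hran : (Set.range e).ncard = k := by
    rw [← Set.image_univ, Set.ncard_image_of_injective _ he, Set.ncard_univ, Nat.card_fin]
  have hsub : {s ∈ factorsOfLength x (n + 1) | f s = u} ⊆ Set.range e :=
    fun s hs => hfe s hs.1 hs.2
  have heq := Set.eq_of_subset_of_ncard_le hsub (by omega) (Set.finite_range e)
  have hmem : e a ∈ {s ∈ factorsOfLength x (n + 1) | f s = u} := heq ▸ ⟨a, rfl⟩
  exact (mem_factorsOfLength_iff.1 hmem.1).1

theorem append_mem_of_rs (hx : IsARSequence x) {u : List (Fin k)}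
    (hu : IsRightSpecial (factors x) u) (a : Fin k) : u ++ [a] ∈ factors x := by
  refine hx.extension_mem (n := u.length) (f := List.dropLast) (e := fun a => u ++ [a])
    (mem_factorsOfLength_iff.2 ⟨hu.1, rfl⟩) (fun s hs => ?_) (fun s hs t ht hst hne => ?_)
    (fun a b hab => by simpa using hab) (fun s hs hsu => ?_) a
  all_goals
    obtain ⟨hs, hslen⟩ := mem_factorsOfLength_iff.1 hs
    obtain rfl | ⟨s, b, rfl⟩ := List.eq_nil_or_concat' s
    · simp at hslen
  · exact mem_factorsOfLength_iff.2 ⟨by simpa using mem_of_append_left hs, by simpa using hslen⟩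
  · obtain ⟨ht, htlen⟩ := mem_factorsOfLength_iff.1 ht
    obtain rfl | ⟨t, c, rfl⟩ := List.eq_nil_or_concat' t
    · simp at htlen
    obtain rfl : s = t := by simpa using hst
    by_contra hbc
    refine hne ?_
    rw [List.dropLast_concat]
    exact (hx.rightSpecial u.length).unique ⟨by simpa using hslen, mem_of_append_left hs, b, c,
      fun h => hbc (by rw [h]), hs, ht⟩ ⟨rfl, hu⟩
  · exact ⟨b, by rw [← hsu, List.dropLast_concat]⟩

theorem cons_mem_of_ls (hx : IsARSequence x) {u : List (Fin k)}
    (hu : IsLeftSpecial (factors x) u) (a : Fin k) : a :: u ∈ factors x := by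
  refine hx.extension_mem (n := u.length) (f := List.tail) (e := fun a => a :: u)
    (mem_factorsOfLength_iff.2 ⟨hu.1, rfl⟩) (fun s hs => ?_) (fun s hs t ht hst hne => ?_)
    (fun a b hab => by simpa using hab) (fun s hs hsu => ?_) a
  all_goals
    obtain ⟨hs, hslen⟩ := mem_factorsOfLength_iff.1 hs
    obtain _ | ⟨b, s⟩ := s
    · simp at hslen
  · exact mem_factorsOfLength_iff.2 ⟨mem_of_append_right (u := [b]) hs, by simpa using hslen⟩
  · obtain ⟨ht, htlen⟩ := mem_factorsOfLength_iff.1 ht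
    obtain _ | ⟨c, t⟩ := t
    · simp at htlen
    obtain rfl : s = t := hst
    by_contra hbc
    exact hne ((hx.leftSpecial u.length).unique ⟨by simpa using hslen,
      mem_of_append_right (u := [b]) hs, b, c, fun h => hbc (by rw [h]), hs, ht⟩ ⟨rfl, hu⟩)
  · exact ⟨b, by rw [← hsu, List.tail_cons]⟩

theorem isARLanguage (hx : IsARSequence x) : IsARLanguage (factors x) where
  left_mem := mem_of_append_left
  right_mem := mem_of_append_right
  exists_append := exists_append_mem_factors
  exists_cons := hx.uniformlyRecurrent.exists_cons_mem_factors
  existsUnique_rs := hx.rightSpecial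
  existsUnique_ls := hx.leftSpecial
  rs_full := hx.append_mem_of_rs
  ls_full := hx.cons_mem_of_ls
  recurrent := hx.uniformlyRecurrent.exists_infix

end IsARSequence

section Subshift

variable {T : Type*} [AddMonoidWithOne T]

theorem language_subshift {A : Type*} (x : T → A) : language (subshift x) = factors x := by
  ext u
  constructor
  · rintro ⟨y, hy, n, hu⟩
    exact ⟨n, hy n ▸ hu⟩
  · exact fun hu => ⟨x, fun _ => rfl, hu⟩

theorem index_lt_top_iff {A : Type*} (X : Set (T → A)) : index X < ⊤ ↔
    ∃ N : ℕ, ∀ (p : ℕ) (u : List A), u ≠ [] → wordPow u p ∈ language X → p ≤ N := by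
  constructor
  · intro h
    obtain ⟨N, hN⟩ := ENat.ne_top_iff_exists.1 h.ne
    refine ⟨N, fun p u hu hmem => ?_⟩
    have hle : (p : ℕ∞) ≤ index X := le_sSup ⟨p, rfl, u, hu, hmem⟩
    rw [← hN] at hle
    exact_mod_cast hle
  · rintro ⟨N, hN⟩
    refine lt_of_le_of_lt (sSup_le ?_) (ENat.natCast_lt_top N)
    rintro _ ⟨p, rfl, u, hu, hmem⟩
    exact_mod_cast hN p u hu hmem

theorem isIndexSequence_iff {A : Type*} {X : Set (T → A)} {i : ℕ → A} :
    IsIndexSequence X i ↔ ∃ w, IsBispecialEnumeration (language X) w ∧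
      ∀ n, IsRightSpecial (language X) (i n :: w n) := by
  simp only [IsIndexSequence, IsBispecialEnumeration, and_assoc]

/-- The result for an arbitrary index set, which covers one-sided and two-sided subshifts. -/
theorem IsARSubshift.index_lt_top_iff_runsBounded {k : ℕ} {X : Set (T → Fin k)}
    (hX : IsARSubshift X) : (∃! i : ℕ → Fin k, IsIndexSequence X i) ∧
      ∀ i : ℕ → Fin k, IsIndexSequence X i → (index X < ⊤ ↔ RunsBounded i) := by
  obtain ⟨x, hx, rfl⟩ := hX
  have h : IsARLanguage (language (subshift x)) := language_subshift x ▸ hx.isARLanguage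
  simp only [isIndexSequence_iff]
  refine ⟨h.existsUnique_index_letters, ?_⟩
  rintro i ⟨w, hw, hi⟩
  rw [index_lt_top_iff]
  exact h.bounded_powers_iff_runsBounded hw hi

end Subshift

end ArnouxRauzy

theorem mainTheorem5 (k : ℕ) (hk : 2 ≤ k) :
    (∀ X : Set (ℕ → Fin k), ArnouxRauzy.IsARSubshift X →
      (∃! i : ℕ → Fin k, ArnouxRauzy.IsIndexSequence X i) ∧
      ∀ i : ℕ → Fin k, ArnouxRauzy.IsIndexSequence X i →
        (ArnouxRauzy.index X < ⊤ ↔ ArnouxRauzy.RunsBounded i)) ∧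
    (∀ X : Set (ℤ → Fin k), ArnouxRauzy.IsARSubshift X →
      (∃! i : ℕ → Fin k, ArnouxRauzy.IsIndexSequence X i) ∧
      ∀ i : ℕ → Fin k, ArnouxRauzy.IsIndexSequence X i →
        (ArnouxRauzy.index X < ⊤ ↔ ArnouxRauzy.RunsBounded i)) := by
  exact ⟨fun X hX => hX.index_lt_top_iff_runsBounded, fun X hX => hX.index_lt_top_iff_runsBounded⟩
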